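/- **Proposition 10.1.** Let $A$ be a unital $C^*$-algebra, let $\alpha: A\to A$ be an injective $*$-endomorphism with $\alpha(1)=1$, and let $E$ be a conditional expectation from $A$ onto the range $\alpha(A)$, that is, a positive linear map $E:A\to\alpha(A)$ with $E(c)=c$, $E(cb)=cE(b)$ and $E(bc)=E(b)c$ for all $c\in\alpha(A)$, $b\in A$. Assume that $E$ is of index-finite type: there are finitely many $u_1,\dots,u_m\in A$ with $a=\sum_{i=1}^m u_iE(u_i^*a)$ for all $a\in A$. Put $\mathcal L=\alpha^{-1}\circ E$. Let $\mathcal T(A,\alpha,\mathcal L)$ be the universal unital $C^*$-algebra generated by a copy of $A$ and an element $\hat S$ subject to the relations $\hat Sa=\alpha(a)\hat S$ and $\hat S^*a\hat S=\mathcal L(a)$ for all $a\in A$. A redundancy is a pair $(a,k)$ with $a\in A$ and $k$ in the closed linear span of $A\hat S\hat S^*A$ such that $ab\hat S=kb\hat S$ for all $b\in A$. Let $A\rtimes_{\alpha,\mathcal L}\mathbb N$ be the quotient of $\mathcal T(A,\alpha,\mathcal L)$ by the closed two-sided ideal generated by the differences $a-k$, for all redundancies $(a,k)$, and let $S$ be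 the image of $\hat S$ in it. Let $h$ be a self-adjoint element of the center of $A$ with $h\ge c\cdot 1$ for some real number $c>1$, and let $\sigma^h$ be the gauge action associated to $h$, i.e. the one-parameter automorphism group of $A\rtimes_{\alpha,\mathcal L}\mathbb N$ determined by $\sigma^h_t(S)=h^{it}S$ and $\sigma^h_t(a)=a$ for all $t\in\mathbb R$, $a\in A$ (elements of $A$ are identified with their images in the quotient, and $h^{it}=\exp(it\log h)$). An element $y$ is analytic if $t\mapsto\sigma^h_t(y)$ extends to an entire function $z\mapsto\sigma^h_z(y)$, and a ground state is a state $\psi$ on $A\rtimes_{\alpha,\mathcal L}\mathbb N$ such that $$\sup_{\operatorname{Im} z\ge 0}|\psi(x\,\sigma^h_z(y))|<\infty$$ for all analytic elements $x,y$. Then there are no ground states on $A\rtimes_{\alpha,\mathcal L}\mathbb N$. -/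

import Mathlib

open scoped Topology

namespace CStarQuotient

variable {B : Type*} [CStarAlgebra B] (I : Ideal B)

/-- Elements `x` of an ideal with `star x` also in the ideal. -/
def symmPart : NonUnitalStarSubalgebra ℂ B where
  carrier := {x | x ∈ I ∧ star x ∈ I}
  add_mem' ha hb := ⟨I.add_mem ha.1 hb.1, by rw [star_add]; exact I.add_mem ha.2 hb.2⟩
  zero_mem' := ⟨I.zero_mem, by rw [star_zero]; exact I.zero_mem⟩
  mul_mem' {a b} ha hb := ⟨I.mul_mem_left a hb.1, by rw [star_mul]; exact I.mul_mem_left _ ha.2⟩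
  smul_mem' c x hx := by
    refine ⟨?_, ?_⟩
    · rw [Algebra.smul_def]; exact I.mul_mem_left _ hx.1
    · rw [star_smul, Algebra.smul_def]; exact I.mul_mem_left _ hx.2
  star_mem' ha := ⟨ha.2, by rw [star_star]; exact ha.1⟩

theorem exists_approx (hI : IsClosed (I : Set B)) {y : B} (hy : y ∈ I) (hy' : star y ∈ I)
    {ε : ℝ} (hε : 0 < ε) :
    ∃ e ∈ I, IsSelfAdjoint e ∧ ‖1 - e‖ ≤ 1 ∧ ‖y * (1 - e)‖ < ε := by
  have hcl : IsClosed ((symmPart I : NonUnitalStarSubalgebra ℂ B) : Set B) :=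
    hI.inter (hI.preimage continuous_star)
  let : NonUnitalCStarAlgebra (symmPart I) :=
    NonUnitalStarSubalgebra.nonUnitalCStarAlgebra _ (h_closed := hcl)
  let := CStarAlgebra.spectralOrder (symmPart I)
  have := CStarAlgebra.spectralOrderedRing (symmPart I)
  let := CStarAlgebra.spectralOrder B
  have := CStarAlgebra.spectralOrderedRing B
  have hu := CStarAlgebra.increasingApproximateUnit (symmPart I)
  have := hu.neBot
  have ht := hu.tendsto_mul_left ⟨y, hy, hy'⟩
  have h1 := ht.eventually (Metric.ball_mem_nhds _ hε)
  obtain ⟨e, he1, he2, he3⟩ := (h1.and (hu.eventually_nonneg.and hu.eventually_norm)).exists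
  have hpos : 0 ≤ (e : B) := by
    obtain ⟨b, rfl⟩ := CStarAlgebra.nonneg_iff_eq_star_mul_self.mp he2
    exact star_mul_self_nonneg (b : B)
  refine ⟨e, e.2.1, .of_nonneg hpos, ?_, ?_⟩
  · have hm : (e : B) ∈ Set.Icc 0 1 :=
      CStarAlgebra.mem_Icc_iff_norm_le_one.mpr ⟨hpos, he3⟩
    exact (CStarAlgebra.mem_Icc_iff_norm_le_one.mp (Set.sub_mem_Icc_zero_iff_right.mpr hm)).2
  · have h2 : dist (y * (e : B)) y < ε := he1
    rw [dist_eq_norm, norm_sub_rev] at h2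
    rwa [mul_sub, mul_one]

/-- Closed two-sided ideals of C⋆-algebras are self-adjoint. -/
theorem star_mem [I.IsTwoSided] (hI : IsClosed (I : Set B)) {x : B} (hx : x ∈ I) : star x ∈ I := by
  rw [← SetLike.mem_coe, ← hI.closure_eq, Metric.mem_closure_iff]
  intro ε hε
  have hxx : star x * x ∈ I := I.mul_mem_left _ hx
  obtain ⟨e, he, hsa, hn, hlt⟩ := exists_approx I hI hxx (by simpa using hxx)
    (show 0 < ε ^ 2 by positivity)
  refine ⟨e * star x, I.mul_mem_right _ he, ?_⟩
  have hsa' : star (1 - e) = 1 - e := by rw [star_sub, star_one, hsa.star_eq]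
  have h2 : star x - e * star x = star (x * (1 - e)) := by
    rw [star_mul, hsa', sub_mul, one_mul]
  rw [dist_eq_norm, h2, norm_star]
  have h3 : ‖x * (1 - e)‖ ^ 2 < ε ^ 2 := by
    rw [sq, ← CStarRing.norm_star_mul_self, star_mul, hsa']
    calc ‖(1 - e) * star x * (x * (1 - e))‖ = ‖(1 - e) * (star x * x * (1 - e))‖ := by
          simp only [mul_assoc]
      _ ≤ ‖1 - e‖ * ‖star x * x * (1 - e)‖ := norm_mul_le _ _
      _ ≤ 1 * ‖star x * x * (1 - e)‖ := by gcongr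
      _ < ε ^ 2 := by rwa [one_mul]
  exact lt_of_pow_lt_pow_left₀ 2 hε.le h3

/-- The quotient of a C⋆-algebra by a closed two-sided ideal, with the quotient norm. -/
@[reducible]
noncomputable def cstarAlgebra [I.IsTwoSided] (hI : IsClosed (I : Set B)) : CStarAlgebra (B ⧸ I) :=
  haveI := hI
  letI : NormedRing (B ⧸ I) :=
    { Submodule.Quotient.normedAddCommGroup I, (inferInstance : Ring (B ⧸ I)) with
      dist_eq := (Submodule.Quotient.normedAddCommGroup I).dist_eq
      norm_mul_le := by
        intro x y
        refine le_of_forall_gt_imp_ge_of_dense fun r hr => ?_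
        have hc : Filter.Tendsto (fun ε : ℝ => (‖x‖ + ε) * (‖y‖ + ε)) (𝓝[>] 0)
            (𝓝 ((‖x‖ + 0) * (‖y‖ + 0))) :=
          (Continuous.tendsto (by fun_prop) 0).mono_left nhdsWithin_le_nhds
        rw [add_zero, add_zero] at hc
        obtain ⟨ε, hε1, hε⟩ :=
          ((hc.eventually (gt_mem_nhds hr)).and self_mem_nhdsWithin).exists
        obtain ⟨a, rfl, ha⟩ := Submodule.Quotient.norm_mk_lt x hε
        obtain ⟨b, rfl, hb⟩ := Submodule.Quotient.norm_mk_lt y hε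
        calc _ ≤ ‖a * b‖ := Submodule.Quotient.norm_mk_le I (a * b)
          _ ≤ ‖a‖ * ‖b‖ := norm_mul_le a b
          _ ≤ _ := by gcongr
          _ ≤ r := hε1.le }
  letI : StarRing (B ⧸ I) :=
    { star := Quotient.map' star (by
        intro a b h
        rw [Submodule.quotientRel_def] at h ⊢
        rw [← star_sub]; exact star_mem I hI h)
      star_involutive := by rintro ⟨x⟩; exact congrArg (Ideal.Quotient.mk I) (star_star x)
      star_mul := by rintro ⟨x⟩ ⟨y⟩; exact congrArg (Ideal.Quotient.mk I) (star_mul x y)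
      star_add := by rintro ⟨x⟩ ⟨y⟩; exact congrArg (Ideal.Quotient.mk I) (star_add x y) }
  { (inferInstance : NormedRing (B ⧸ I)), (inferInstance : StarRing (B ⧸ I)),
    (inferInstance : Algebra ℂ (B ⧸ I)) with
    norm_smul_le := (Submodule.Quotient.normedSpace I ℂ).norm_smul_le
    complete := (Submodule.Quotient.completeSpace I).complete
    star_smul := by rintro c ⟨x⟩; exact congrArg (Ideal.Quotient.mk I) (star_smul c x)
    norm_mul_self_le := by
      rintro ⟨x⟩
      refine le_of_forall_pos_lt_add fun ε hε => ?_
      obtain ⟨z, hz, hzn⟩ := Submodule.Quotient.norm_mk_lt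
        (Ideal.Quotient.mk I (star x * x)) (half_pos hε)
      have hj : z - star x * x ∈ I := Ideal.Quotient.eq.mp hz
      obtain ⟨e, he, hsa, hn, hlt⟩ := exists_approx I hI hj (star_mem I hI hj) (half_pos hε)
      have hsa' : star (1 - e) = 1 - e := by rw [star_sub, star_one, hsa.star_eq]
      have hq : Ideal.Quotient.mk I x = Ideal.Quotient.mk I (x * (1 - e)) := by
        refine Ideal.Quotient.eq.mpr ?_
        rw [mul_sub, mul_one, sub_sub_cancel]
        exact I.mul_mem_left _ he
      have h1 : ‖Ideal.Quotient.mk I x‖ ≤ ‖x * (1 - e)‖ := by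
        rw [hq]; exact Submodule.Quotient.norm_mk_le I _
      change ‖Ideal.Quotient.mk I x‖ * ‖Ideal.Quotient.mk I x‖ <
        ‖Ideal.Quotient.mk I (star x * x)‖ + ε
      calc ‖Ideal.Quotient.mk I x‖ * ‖Ideal.Quotient.mk I x‖
          ≤ ‖x * (1 - e)‖ * ‖x * (1 - e)‖ := by gcongr
        _ = ‖(1 - e) * (z * (1 - e) - (z - star x * x) * (1 - e))‖ := by
          rw [← CStarRing.norm_star_mul_self, star_mul, hsa', ← sub_mul, sub_sub_cancel]
          simp only [mul_assoc]
        _ ≤ ‖1 - e‖ * ‖z * (1 - e) - (z - star x * x) * (1 - e)‖ := norm_mul_le _ _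
        _ ≤ 1 * (‖z‖ * ‖1 - e‖ + ‖(z - star x * x) * (1 - e)‖) := by
          gcongr
          exact (norm_sub_le _ _).trans (by gcongr; exact norm_mul_le _ _)
        _ ≤ 1 * (‖z‖ * 1 + ‖(z - star x * x) * (1 - e)‖) := by gcongr
        _ < _ := by linarith }

/-- The quotient map as a `*`-homomorphism. -/
noncomputable def mk [I.IsTwoSided] (hI : IsClosed (I : Set B)) :
    letI := cstarAlgebra I hI
    B →⋆ₐ[ℂ] B ⧸ I :=
  letI := cstarAlgebra I hI
  { Ideal.Quotient.mkₐ ℂ I with map_star' := fun _ => rfl }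

end CStarQuotient

open scoped ComplexOrder ENNReal

universe u

theorem continuous_starAlgHom {B D : Type*} [CStarAlgebra B] [CStarAlgebra D] (f : B →⋆ₐ[ℂ] D) :
    Continuous f :=
  AddMonoidHomClass.continuous_of_bound f 1 fun x => by
    rw [one_mul]; exact NonUnitalStarAlgHom.norm_apply_le f x

/-- A conditional expectation from a unital C⋆-algebra `B` onto a unital C⋆-subalgebra `C`: a
positive `C`-bimodule map `B → C` restricting to the identity on `C`
(such a map is automatically contractive). -/
structure IsConditionalExpectation {B : Type*} [CStarAlgebra B] [PartialOrder B] [StarOrderedRing B]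
    (C : StarSubalgebra ℂ B) (E : B →ₗ[ℂ] C) : Prop where
  map_coe : ∀ c : C, E (c : B) = c
  map_mul_left : ∀ (c : C) (b : B), E ((c : B) * b) = c * E b
  map_mul_right : ∀ (b : B) (c : C), E (b * (c : B)) = E b * c
  nonneg : ∀ b : B, 0 ≤ b → 0 ≤ (E b : B)

/-- `E` is of index-finite type: it has a finite quasi-basis `u₁, …, uₘ`. -/
def IsIndexFinite {B : Type*} [CStarAlgebra B] {C : StarSubalgebra ℂ B} (E : B →ₗ[ℂ] C) : Prop :=
  ∃ (m : ℕ) (v : Fin m → B), ∀ b : B, b = ∑ i, v i * (E (star (v i) * b) : B)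

/-- The transfer operator `α⁻¹ ∘ E`. -/
noncomputable def transferOperator {A : Type*} [CStarAlgebra A] (α : A →⋆ₐ[ℂ] A)
    (hα : Function.Injective α) (E : A →ₗ[ℂ] α.range) : A →ₗ[ℂ] A :=
  (StarAlgEquiv.ofInjective α hα).symm.toAlgEquiv.toLinearMap ∘ₗ E

theorem map_transferOperator {A : Type*} [CStarAlgebra A] (α : A →⋆ₐ[ℂ] A)
    (hα : Function.Injective α) (E : A →ₗ[ℂ] α.range) (a : A) :
    α (transferOperator α hα E a) = E a :=
  congrArg Subtype.val ((StarAlgEquiv.ofInjective α hα).apply_symm_apply (E a))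

/-- A representation in a nonzero unital C⋆-algebra `B` of the relations
`Ŝ a = α(a) Ŝ` and `Ŝ⋆ a Ŝ = L(a)`. Algebras `B` in the universe of `A` suffice: the C⋆-subalgebra
generated by the images of `A` and `Ŝ` has a dense subset of cardinality at most that of
`A` (or the continuum), hence is isomorphic to a C⋆-algebra in the universe of `A`. -/
structure CovRep {A : Type u} [CStarAlgebra A] (α : A →⋆ₐ[ℂ] A) (L : A →ₗ[ℂ] A) where
  /-- the target algebra -/
  B : Type u
  [cstar : CStarAlgebra B]
  [nontriv : Nontrivial B]
  /-- the image of `A` -/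
  rep : A →⋆ₐ[ℂ] B
  /-- the image of `Ŝ` -/
  s : B
  s_mul : ∀ a, s * rep a = rep (α a) * s
  star_s_mul : ∀ a, star s * rep a * s = rep (L a)

attribute [instance] CovRep.cstar CovRep.nontriv

section Construction

variable {A : Type u} [CStarAlgebra A] (α : A →⋆ₐ[ℂ] A) (L : A →ₗ[ℂ] A)

/-- The C⋆-algebra of all bounded families indexed by all the representations. -/
abbrev RepProduct : Type (u + 1) := lp (fun i : CovRep α L => i.B) ∞

noncomputable instance RepProduct.cstarAlgebra : CStarAlgebra (RepProduct α L) where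

namespace RepProduct

/-- The family of all the images of `a`. -/
noncomputable def ofA (a : A) : RepProduct α L :=
  ⟨fun i => i.rep a, memℓp_infty ⟨‖a‖, by
    rintro _ ⟨i, rfl⟩; exact NonUnitalStarAlgHom.norm_apply_le i.rep a⟩⟩

/-- The family of all the images of `Ŝ`. -/
noncomputable def S : RepProduct α L :=
  ⟨fun i => i.s, memℓp_infty ⟨‖L 1‖ + 1, by
    rintro _ ⟨i, rfl⟩
    have h : ‖i.s‖ * ‖i.s‖ ≤ ‖L 1‖ := by
      have h1 := i.star_s_mul 1
      rw [map_one, mul_one] at h1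
      rw [← CStarRing.norm_star_mul_self, h1]
      exact NonUnitalStarAlgHom.norm_apply_le i.rep _
    show ‖i.s‖ ≤ ‖L 1‖ + 1
    nlinarith [norm_nonneg i.s, norm_nonneg (L 1)]⟩⟩

end RepProduct

/-- The Toeplitz extension, i.e. the universal unital C⋆-algebra generated by `A` and `Ŝ` subject
to `Ŝ a = α(a) Ŝ` and `Ŝ⋆ a Ŝ = L(a)`: the C⋆-algebra generated by the universal families inside the
product of all representations of these relations. -/
noncomputable def toeplitzSubalgebra : StarSubalgebra ℂ (RepProduct α L) :=
  (StarAlgebra.adjoin ℂ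
    (Set.range (RepProduct.ofA α L) ∪ {RepProduct.S α L})).topologicalClosure

/-- The Toeplitz extension `𝒯(A, α, L)`. -/
abbrev Toeplitz : Type (u + 1) := toeplitzSubalgebra α L

noncomputable instance Toeplitz.cstarAlgebra : CStarAlgebra (Toeplitz α L) :=
  StarSubalgebra.cstarAlgebra _ (h_closed := StarSubalgebra.isClosed_topologicalClosure _)

namespace Toeplitz

/-- The canonical map from `A` to the Toeplitz extension. -/
noncomputable def ofA : A →⋆ₐ[ℂ] Toeplitz α L where
  toFun a := ⟨RepProduct.ofA α L a, StarSubalgebra.le_topologicalClosure _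
    (StarAlgebra.subset_adjoin ℂ _ (.inl ⟨a, rfl⟩))⟩
  map_one' := by ext i; exact map_one i.rep
  map_mul' a b := by ext i; exact map_mul i.rep a b
  map_zero' := by ext i; exact map_zero i.rep
  map_add' a b := by ext i; exact map_add i.rep a b
  commutes' c := by ext i; exact AlgHomClass.commutes i.rep c
  map_star' a := by ext i; exact map_star i.rep a

/-- The generator `Ŝ` of the Toeplitz extension. -/
noncomputable def S : Toeplitz α L :=
  ⟨RepProduct.S α L, StarSubalgebra.le_topologicalClosure _
    (StarAlgebra.subset_adjoin ℂ _ (.inr rfl))⟩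

theorem S_mul (a : A) : S α L * ofA α L a = ofA α L (α a) * S α L := by
  ext i; exact i.s_mul a

theorem star_S_mul (a : A) : star (S α L) * ofA α L a * S α L = ofA α L (L a) := by
  ext i; exact i.star_s_mul a

/-- The `*`-homomorphism out of the Toeplitz extension given by a representation. -/
noncomputable def eval (i : CovRep α L) : Toeplitz α L →⋆ₐ[ℂ] i.B where
  toFun x := (x : RepProduct α L) i
  map_one' := rfl
  map_mul' _ _ := rfl
  map_zero' := rfl
  map_add' _ _ := rfl
  commutes' _ := rfl
  map_star' _ := rfl

theorem eval_ofA (i : CovRep α L) (a : A) : eval α L i (ofA α L a) = i.rep a := rfl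

theorem eval_S (i : CovRep α L) : eval α L i (S α L) = i.s := rfl

/-- Two `*`-homomorphisms agreeing on `A` and on `Ŝ` are equal. -/
theorem hom_ext {D : Type*} [CStarAlgebra D] {f g : Toeplitz α L →⋆ₐ[ℂ] D}
    (hA : ∀ a, f (ofA α L a) = g (ofA α L a)) (hS : f (S α L) = g (S α L)) : f = g := by
  have hcl : IsClosed ((((StarAlgHom.equalizer f g).map (toeplitzSubalgebra α L).subtype :
      StarSubalgebra ℂ (RepProduct α L))) : Set (RepProduct α L)) := by
    have h1 : IsClosed {x : Toeplitz α L | f x = g x} :=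
      isClosed_eq (continuous_starAlgHom f) (continuous_starAlgHom g)
    exact (StarSubalgebra.isClosed_topologicalClosure _).isClosedEmbedding_subtypeVal.isClosedMap
      _ h1
  have hle : toeplitzSubalgebra α L ≤
      (StarAlgHom.equalizer f g).map (toeplitzSubalgebra α L).subtype := by
    refine StarSubalgebra.topologicalClosure_minimal (StarAlgebra.adjoin_le ?_) hcl
    rintro _ (⟨a, rfl⟩ | rfl)
    · exact ⟨ofA α L a, hA a, rfl⟩
    · exact ⟨S α L, hS, rfl⟩
  ext x
  obtain ⟨y, hy, hyx⟩ := hle x.2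
  rw [← Subtype.ext hyx]
  exact hy

/-- The family of twisted representations `(π, s) ↦ (π, π(u) s)`, for a central unitary `u`. -/
def twist {u : A} (hu : u ∈ unitary A) (hc : u ∈ Set.center A) (i : CovRep α L) : CovRep α L where
  B := i.B
  rep := i.rep
  s := i.rep u * i.s
  s_mul a := by
    rw [mul_assoc, i.s_mul, ← mul_assoc, ← mul_assoc, ← map_mul, ← map_mul,
      (Set.mem_center_iff.mp hc).comm]
  star_s_mul a := by
    have h : star u * a * u = a := by
      rw [mul_assoc, ← (Set.mem_center_iff.mp hc).comm a, ← mul_assoc,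
        Unitary.star_mul_self_of_mem hu, one_mul]
    rw [star_mul, ← map_star]
    calc star i.s * i.rep (star u) * i.rep a * (i.rep u * i.s)
        = star i.s * i.rep (star u * a * u) * i.s := by simp only [map_mul, mul_assoc]
      _ = _ := by rw [h, i.star_s_mul]

/-- Reindexing of families along the twist by `u`. -/
noncomputable def reindex {u : A} (hu : u ∈ unitary A) (hc : u ∈ Set.center A) :
    RepProduct α L →⋆ₐ[ℂ] RepProduct α L where
  toFun x := ⟨fun i => x (twist α L hu hc i), memℓp_infty ⟨‖x‖, by
    rintro _ ⟨i, rfl⟩; exact lp.norm_apply_le_norm ENNReal.top_ne_zero x (twist α L hu hc i)⟩⟩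
  map_one' := rfl
  map_mul' _ _ := rfl
  map_zero' := rfl
  map_add' _ _ := rfl
  commutes' _ := rfl
  map_star' _ := rfl

theorem reindex_ofA {u : A} (hu : u ∈ unitary A) (hc : u ∈ Set.center A) (a : A) :
    reindex α L hu hc (ofA α L a) = ofA α L a := rfl

theorem reindex_S {u : A} (hu : u ∈ unitary A) (hc : u ∈ Set.center A) :
    reindex α L hu hc (S α L) = (ofA α L u * S α L : Toeplitz α L) := rfl

theorem reindex_mem {u : A} (hu : u ∈ unitary A) (hc : u ∈ Set.center A) (x : Toeplitz α L) :
    reindex α L hu hc x ∈ toeplitzSubalgebra α L := by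
  have hle : toeplitzSubalgebra α L ≤ (toeplitzSubalgebra α L).comap (reindex α L hu hc) := by
    refine StarSubalgebra.topologicalClosure_minimal (StarAlgebra.adjoin_le ?_)
      ((StarSubalgebra.isClosed_topologicalClosure _).preimage (continuous_starAlgHom (reindex α L hu hc)))
    rintro _ (⟨a, rfl⟩ | rfl)
    · exact (ofA α L a).2
    · exact (ofA α L u * S α L).2
  exact hle x.2

/-- The `*`-endomorphism fixing `A` and mapping `Ŝ` to `u Ŝ`, for a central unitary `u`. -/
noncomputable def gaugeHom {u : A} (hu : u ∈ unitary A) (hc : u ∈ Set.center A) :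
    Toeplitz α L →⋆ₐ[ℂ] Toeplitz α L :=
  ((reindex α L hu hc).comp (toeplitzSubalgebra α L).subtype).codRestrict _ (reindex_mem α L hu hc)

theorem gaugeHom_ofA {u : A} (hu : u ∈ unitary A) (hc : u ∈ Set.center A) (a : A) :
    gaugeHom α L hu hc (ofA α L a) = ofA α L a := rfl

theorem gaugeHom_S {u : A} (hu : u ∈ unitary A) (hc : u ∈ Set.center A) :
    gaugeHom α L hu hc (S α L) = ofA α L u * S α L := rfl

theorem gaugeHom_comp {u v : A} (hu : u ∈ unitary A) (hcu : u ∈ Set.center A)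
    (hv : v ∈ unitary A) (hcv : v ∈ Set.center A) (huv : u * v = 1) (x : Toeplitz α L) :
    gaugeHom α L hu hcu (gaugeHom α L hv hcv x) = x := by
  refine DFunLike.congr_fun (hom_ext α L (f := (gaugeHom α L hu hcu).comp (gaugeHom α L hv hcv))
    (g := StarAlgHom.id ℂ _) ?_ ?_) x
  · intro a; rfl
  · have hvu : v * u = 1 := by rw [← (Set.mem_center_iff.mp hcu).comm]; exact huv
    rw [StarAlgHom.comp_apply, gaugeHom_S, map_mul, gaugeHom_ofA, gaugeHom_S, ← mul_assoc,
      ← map_mul, hvu, map_one, one_mul]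
    rfl

/-- The closed linear span of `A Ŝ Ŝ⋆ A`. -/
noncomputable def corner : Submodule ℂ (Toeplitz α L) :=
  (Submodule.span ℂ
    {x | ∃ a b : A, x = ofA α L a * S α L * star (S α L) * ofA α L b}).topologicalClosure

/-- `(a, k)` is a redundancy. -/
def IsRedundancy (a : A) (k : Toeplitz α L) : Prop :=
  k ∈ corner α L ∧ ∀ b : A, ofA α L a * ofA α L b * S α L = k * ofA α L b * S α L

/-- The closed two-sided ideal generated by the differences `a - k`, for all redundancies
`(a, k)`. -/
noncomputable def redundancyIdeal : Ideal (Toeplitz α L) :=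
  sInf {J | J.IsTwoSided ∧ IsClosed (J : Set (Toeplitz α L)) ∧
    ∀ a k, IsRedundancy α L a k → ofA α L a - k ∈ J}

instance : (redundancyIdeal α L).IsTwoSided where
  mul_mem_of_left b ha := by
    rw [redundancyIdeal, Submodule.mem_sInf] at ha ⊢
    intro J hJ
    exact hJ.1.mul_mem_of_left b (ha J hJ)

theorem isClosed_redundancyIdeal : IsClosed (redundancyIdeal α L : Set (Toeplitz α L)) := by
  rw [redundancyIdeal, Submodule.coe_sInf]
  exact isClosed_biInter fun J hJ => hJ.2.1

theorem sub_mem_redundancyIdeal {a : A} {k : Toeplitz α L} (h : IsRedundancy α L a k) :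
    ofA α L a - k ∈ redundancyIdeal α L :=
  Submodule.mem_sInf.mpr fun _ hJ => hJ.2.2 a k h

theorem gaugeHom_mem_corner {u : A} (hu : u ∈ unitary A) (hc : u ∈ Set.center A)
    {k : Toeplitz α L} (hk : k ∈ corner α L) : gaugeHom α L hu hc k ∈ corner α L := by
  have hle : corner α L ≤ (corner α L).comap (gaugeHom α L hu hc).toAlgHom.toLinearMap := by
    refine Submodule.topologicalClosure_minimal _ (Submodule.span_le.mpr ?_)
      ((Submodule.isClosed_topologicalClosure _).preimage (continuous_starAlgHom (gaugeHom α L hu hc)))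
    rintro _ ⟨a, b, rfl⟩
    refine Submodule.le_topologicalClosure _ (Submodule.subset_span ⟨a * u, star u * b, ?_⟩)
    change gaugeHom α L hu hc _ = _
    simp only [map_mul, map_star, gaugeHom_ofA, gaugeHom_S, star_mul, mul_assoc]
  exact hle hk

theorem gaugeHom_redundancy {u : A} (hu : u ∈ unitary A) (hc : u ∈ Set.center A)
    {a : A} {k : Toeplitz α L} (h : IsRedundancy α L a k) :
    IsRedundancy α L a (gaugeHom α L hu hc k) := by
  refine ⟨gaugeHom_mem_corner α L hu hc h.1, fun b => ?_⟩
  have h1 := congrArg (gaugeHom α L hu hc) (h.2 (b * star u))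
  simp only [map_mul, gaugeHom_ofA, gaugeHom_S] at h1
  have h2 : ofA α L (star u) * ofA α L u = 1 := by
    rw [← map_mul, Unitary.star_mul_self_of_mem hu, map_one]
  have h3 : ofA α L (star u) * (ofA α L u * S α L) = S α L := by rw [← mul_assoc, h2, one_mul]
  simp only [mul_assoc, h3] at h1 ⊢
  exact h1

theorem gaugeHom_mem_ideal {u : A} (hu : u ∈ unitary A) (hc : u ∈ Set.center A)
    {x : Toeplitz α L} (hx : x ∈ redundancyIdeal α L) :
    gaugeHom α L hu hc x ∈ redundancyIdeal α L := by
  have hle : redundancyIdeal α L ≤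
      (redundancyIdeal α L).comap (gaugeHom α L hu hc).toAlgHom.toRingHom := by
    refine sInf_le ⟨⟨fun {a} b ha => ?_⟩, (isClosed_redundancyIdeal α L).preimage
      (continuous_starAlgHom (gaugeHom α L hu hc)), fun a k hk => ?_⟩
    · rw [Ideal.mem_comap, map_mul]
      exact Ideal.mul_mem_right _ _ ha
    · change gaugeHom α L hu hc (ofA α L a - k) ∈ redundancyIdeal α L
      rw [map_sub, gaugeHom_ofA]
      exact sub_mem_redundancyIdeal α L (gaugeHom_redundancy α L hu hc hk)
  exact hle hx

end Toeplitz

/-- The crossed product `A ⋊_{α,L} ℕ`: the quotient of the Toeplitz extension by the closed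
two-sided ideal generated by the differences `a - k`, for all redundancies `(a, k)`. -/
def CrossedProduct : Type (u + 1) := Toeplitz α L ⧸ Toeplitz.redundancyIdeal α L

noncomputable instance CrossedProduct.cstarAlgebra : CStarAlgebra (CrossedProduct α L) :=
  CStarQuotient.cstarAlgebra _ (Toeplitz.isClosed_redundancyIdeal α L)

namespace CrossedProduct

/-- The canonical quotient map. -/
noncomputable def q : Toeplitz α L →⋆ₐ[ℂ] CrossedProduct α L :=
  CStarQuotient.mk _ (Toeplitz.isClosed_redundancyIdeal α L)

theorem q_surjective : Function.Surjective (q α L) := Ideal.Quotient.mk_surjective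

theorem q_eq_zero_iff (x : Toeplitz α L) : q α L x = 0 ↔ x ∈ Toeplitz.redundancyIdeal α L :=
  Ideal.Quotient.eq_zero_iff_mem

/-- The canonical map from `A` to the crossed product. -/
noncomputable def ofA : A →⋆ₐ[ℂ] CrossedProduct α L := (q α L).comp (Toeplitz.ofA α L)

/-- The image `S` of `Ŝ` in the crossed product. -/
noncomputable def S : CrossedProduct α L := q α L (Toeplitz.S α L)

/-- The `*`-endomorphism of the crossed product obtained by passing to the quotient. -/
noncomputable def gaugeHom {u : A} (hu : u ∈ unitary A) (hc : u ∈ Set.center A) :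
    CrossedProduct α L →⋆ₐ[ℂ] CrossedProduct α L :=
  { Ideal.Quotient.liftₐ (Toeplitz.redundancyIdeal α L)
      ((q α L).comp (Toeplitz.gaugeHom α L hu hc)).toAlgHom
      (fun _ hx => (q_eq_zero_iff α L _).mpr (Toeplitz.gaugeHom_mem_ideal α L hu hc hx)) with
    map_star' := by
      intro x
      obtain ⟨y, rfl⟩ := q_surjective α L x
      rw [← map_star]
      exact map_star ((q α L).comp (Toeplitz.gaugeHom α L hu hc)) y }

theorem gaugeHom_q {u : A} (hu : u ∈ unitary A) (hc : u ∈ Set.center A) (x : Toeplitz α L) :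
    gaugeHom α L hu hc (q α L x) = q α L (Toeplitz.gaugeHom α L hu hc x) := rfl

/-- The automorphism `σ_u` of the crossed product with `σ_u(a) = a` and `σ_u(S) = u S`, for a
central unitary `u`. -/
noncomputable def gaugeAut {u : A} (hu : u ∈ unitary A) (hc : u ∈ Set.center A) :
    CrossedProduct α L ≃⋆ₐ[ℂ] CrossedProduct α L :=
  StarAlgEquiv.ofStarAlgHom (gaugeHom α L hu hc)
    (gaugeHom α L (Unitary.star_mem hu) (Set.star_mem_center hc))
    (by
      ext x
      obtain ⟨y, rfl⟩ := q_surjective α L x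
      exact congrArg (q α L) (Toeplitz.gaugeHom_comp α L _ _ hu hc
        (Unitary.star_mul_self_of_mem hu) y))
    (by
      ext x
      obtain ⟨y, rfl⟩ := q_surjective α L x
      exact congrArg (q α L) (Toeplitz.gaugeHom_comp α L hu hc _ _
        (Unitary.mul_star_self_of_mem hu) y))

end CrossedProduct

/-- The unitary `h^{it} = exp (i t log h)`, for a positive invertible `h`. -/
noncomputable def imaginaryPower (h : A) (t : ℝ) : unitary A :=
  selfAdjoint.expUnitary (t • (⟨CFC.log h, IsSelfAdjoint.log⟩ : selfAdjoint A))

theorem imaginaryPower_eq (h : A) (t : ℝ) :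
    (imaginaryPower h t : A) = NormedSpace.exp (Complex.I • (t • CFC.log h)) := rfl

theorem imaginaryPower_mem_center {h : A} (hc : h ∈ Set.center A) (t : ℝ) :
    (imaginaryPower h t : A) ∈ Set.center A := by
  rw [Semigroup.mem_center_iff]
  intro b
  have h1 : Commute (CFC.log h) b :=
    Commute.cfc_real (show Commute h b from ((Set.mem_center_iff.mp hc).comm b)) Real.log
  rw [imaginaryPower_eq]
  exact (((h1.smul_left t).smul_left Complex.I).exp_left).symm.eq

/-- The gauge action `σ^h` of `ℝ` on the crossed product associated to a central `h ≥ c > 0`: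
`σ_t(a) = a` and `σ_t(S) = h^{it} S`. -/
noncomputable def gaugeAction {h : A} (hc : h ∈ Set.center A) (t : ℝ) :
    CrossedProduct α L ≃⋆ₐ[ℂ] CrossedProduct α L :=
  CrossedProduct.gaugeAut α L (imaginaryPower h t).2 (imaginaryPower_mem_center hc t)

theorem gaugeAction_ofA {h : A} (hc : h ∈ Set.center A) (t : ℝ) (a : A) :
    gaugeAction α L hc t (CrossedProduct.ofA α L a) = CrossedProduct.ofA α L a := rfl

theorem gaugeAction_S {h : A} (hc : h ∈ Set.center A) (t : ℝ) :
    gaugeAction α L hc t (CrossedProduct.S α L) =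
      CrossedProduct.ofA α L (imaginaryPower h t) * CrossedProduct.S α L := rfl

end Construction

/-- A state of a unital C⋆-algebra: a positive linear functional `ψ` with `ψ 1 = 1`. -/
structure CStarState (B : Type*) [CStarAlgebra B] extends B →ₗ[ℂ] ℂ where
  nonneg_star_mul_self : ∀ x, 0 ≤ toLinearMap (star x * x)
  apply_one : toLinearMap 1 = 1

/-- `f` is an entire extension `z ↦ σ_z(y)` of `t ↦ σ_t(y)`. -/
def IsEntireExtension {B : Type*} [CStarAlgebra B] (σ : ℝ → B ≃⋆ₐ[ℂ] B) (y : B) (f : ℂ → B) :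
    Prop :=
  Differentiable ℂ f ∧ ∀ t : ℝ, f t = σ t y

/-- `y` is an analytic element for `σ`. -/
def IsAnalyticElement {B : Type*} [CStarAlgebra B] (σ : ℝ → B ≃⋆ₐ[ℂ] B) (y : B) : Prop :=
  ∃ f : ℂ → B, IsEntireExtension σ y f

/-- `ψ` is a ground state for `σ`: `z ↦ ψ(x σ_z(y))` is bounded on the closed upper half plane for
all analytic elements `x`, `y`. (The extension `z ↦ σ_z(y)` is unique, by the identity theorem.) -/
def IsGroundState {B : Type*} [CStarAlgebra B] (σ : ℝ → B ≃⋆ₐ[ℂ] B) (ψ : CStarState B) : Prop :=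
  ∀ x y : B, IsAnalyticElement σ x → ∀ f : ℂ → B, IsEntireExtension σ y f →
    ∃ K : ℝ, ∀ z : ℂ, 0 ≤ z.im → ‖ψ.toLinearMap (x * f z)‖ ≤ K

/-!
A ground state would have to be bounded on the powers `hⁿ`, although `ψ(hⁿ) ≥ cⁿ → ∞`.

If `u₁, …, uₘ` is a quasi-basis of `E`, then `(1, ∑ uᵢ Ŝ Ŝ⋆ uᵢ⋆)` is a redundancy, because
`∑ uᵢ Ŝ Ŝ⋆ uᵢ⋆ b Ŝ = ∑ uᵢ Ŝ L(uᵢ⋆ b) = ∑ uᵢ E(uᵢ⋆ b) Ŝ = b Ŝ`. Hence `∑ uᵢ S S⋆ uᵢ⋆ = 1` in the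
crossed product (`CrossedProduct.sum_mul_S_mul_star_S_mul_star_eq_one`). The elements `uᵢ S` and
`S⋆ uᵢ⋆` are analytic, and the extension of `t ↦ σ_t(S⋆ uᵢ⋆)` is `z ↦ S⋆ h^{-iz} uᵢ⋆`, whose value at
`z = n i` is `S⋆ hⁿ uᵢ⋆`. Since `h` is central, summing `ψ(uᵢ S S⋆ hⁿ uᵢ⋆)` over `i` gives `ψ(hⁿ)`,
so the ground state condition bounds `ψ(hⁿ)` independently of `n`.
-/

section CrossedProductRelations

variable {A : Type u} [CStarAlgebra A]

namespace Toeplitz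

theorem isRedundancy_one_sum {α : A →⋆ₐ[ℂ] A} (hα : Function.Injective α)
    (E : A →ₗ[ℂ] α.range) {m : ℕ} (v : Fin m → A)
    (hv : ∀ b : A, b = ∑ i, v i * (E (star (v i) * b) : A)) :
    IsRedundancy α (transferOperator α hα E) 1
      (∑ i, ofA α (transferOperator α hα E) (v i) * S α (transferOperator α hα E) *
        star (S α (transferOperator α hα E)) *
        ofA α (transferOperator α hα E) (star (v i))) := by
  set L := transferOperator α hα E with hL
  refine ⟨Submodule.sum_mem _ fun i _ => Submodule.le_topologicalClosure _
    (Submodule.subset_span ⟨v i, star (v i), rfl⟩), fun b => ?_⟩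
  have key : ∀ i, ofA α L (v i) * S α L * star (S α L) * ofA α L (star (v i)) * ofA α L b * S α L
      = ofA α L (v i * (E (star (v i) * b) : A)) * S α L := fun i => by
    calc _ = ofA α L (v i) * (S α L * (star (S α L) * ofA α L (star (v i) * b) * S α L)) := by
          rw [map_mul (ofA α L) (star (v i)) b]; simp only [mul_assoc]
      _ = _ := by rw [star_S_mul, S_mul, hL, map_transferOperator,
            map_mul (ofA α (transferOperator α hα E)), mul_assoc]
  simp only [Finset.sum_mul, key]
  rw [map_one, one_mul, ← Finset.sum_mul, ← map_sum, ← hv]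

end Toeplitz

namespace CrossedProduct

/-- A quasi-basis `u₁, …, uₘ` of `E` satisfies `∑ uᵢ S S⋆ uᵢ⋆ = 1` in the crossed product. -/
theorem sum_mul_S_mul_star_S_mul_star_eq_one {α : A →⋆ₐ[ℂ] A} (hα : Function.Injective α)
    (E : A →ₗ[ℂ] α.range) {m : ℕ} (v : Fin m → A)
    (hv : ∀ b : A, b = ∑ i, v i * (E (star (v i) * b) : A)) :
    ∑ i, ofA α (transferOperator α hα E) (v i) * S α (transferOperator α hα E) *
      star (S α (transferOperator α hα E)) * ofA α (transferOperator α hα E) (star (v i)) = 1 := by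
  have h1 := (q_eq_zero_iff α (transferOperator α hα E) _).mpr
    (Toeplitz.sub_mem_redundancyIdeal α _ (Toeplitz.isRedundancy_one_sum hα E v hv))
  rw [map_sub, map_one, map_one, sub_eq_zero, map_sum] at h1
  simp only [map_mul, map_star (q α (transferOperator α hα E))] at h1
  exact h1.symm

end CrossedProduct

theorem star_imaginaryPower (h : A) (t : ℝ) :
    star (imaginaryPower h t : A) = NormedSpace.exp ((-(Complex.I * t)) • CFC.log h) := by
  have hs : star (CFC.log h) = CFC.log h := IsSelfAdjoint.log.star_eq
  rw [imaginaryPower_eq, NormedSpace.star_exp, star_smul, star_smul, hs,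
    star_trivial t, ← Complex.coe_smul, smul_smul]
  simp

theorem differentiable_exp_smul (a : A) {g : ℂ → ℂ} (hg : Differentiable ℂ g) :
    Differentiable ℂ fun z => NormedSpace.exp (g z • a) := fun z =>
  ((hasDerivAt_exp_smul_const a (g z)).scomp z (hg z).hasDerivAt).differentiableAt

variable (α : A →⋆ₐ[ℂ] A) (L : A →ₗ[ℂ] A)

theorem CrossedProduct.differentiable_ofA_comp {g : ℂ → A} (hg : Differentiable ℂ g) :
    Differentiable ℂ fun z => CrossedProduct.ofA α L (g z) :=
  (⟨(CrossedProduct.ofA α L).toAlgHom.toLinearMap, continuous_starAlgHom _⟩ :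
    A →L[ℂ] CrossedProduct α L).differentiable.comp hg

theorem isAnalyticElement_ofA_mul_S {h : A} (hc : h ∈ Set.center A) (a : A) :
    IsAnalyticElement (gaugeAction α L hc)
      (CrossedProduct.ofA α L a * CrossedProduct.S α L) := by
  refine ⟨fun z => CrossedProduct.ofA α L a *
    CrossedProduct.ofA α L (NormedSpace.exp ((Complex.I * z) • CFC.log h)) *
      CrossedProduct.S α L, ?_, fun t => ?_⟩
  · exact ((CrossedProduct.differentiable_ofA_comp α L
      (differentiable_exp_smul _ (by fun_prop))).const_mul _).mul_const _
  · beta_reduce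
    rw [map_mul, gaugeAction_ofA, gaugeAction_S, imaginaryPower_eq, ← Complex.coe_smul, smul_smul,
      mul_assoc]

/-- The entire extension of `t ↦ σ_t(S⋆ a)` is `z ↦ S⋆ h^{-iz} a`. -/
theorem isEntireExtension_star_S_mul_ofA {h : A} (hc : h ∈ Set.center A) (a : A) :
    IsEntireExtension (gaugeAction α L hc)
      (star (CrossedProduct.S α L) * CrossedProduct.ofA α L a)
      fun z => star (CrossedProduct.S α L) *
        CrossedProduct.ofA α L (NormedSpace.exp ((-(Complex.I * z)) • CFC.log h)) *
        CrossedProduct.ofA α L a := by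
  refine ⟨((CrossedProduct.differentiable_ofA_comp α L
      (differentiable_exp_smul _ (by fun_prop))).const_mul _).mul_const _, fun t => ?_⟩
  rw [map_mul, map_star, gaugeAction_ofA, gaugeAction_S, star_mul, ← map_star,
    star_imaginaryPower]

end CrossedProductRelations

section Powers

variable {A : Type*} [CStarAlgebra A] [PartialOrder A] [StarOrderedRing A]

theorem exp_natCast_smul_log {h : A} {c : ℝ} (hc : 0 < c) (hle : algebraMap ℝ A c ≤ h) (n : ℕ) :
    NormedSpace.exp ((n : ℂ) • CFC.log h) = h ^ n := by
  let : NormedAlgebra ℚ A := .restrictScalars ℚ ℂ A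
  have hpos : IsStrictlyPositive h := (isStrictlyPositive_algebraMap hc).of_le hle
  rw [Nat.cast_smul_eq_nsmul, NormedSpace.exp_nsmul, CFC.exp_log h hpos]

theorem algebraMap_pow_le_pow {h : A} (hsa : IsSelfAdjoint h) {c : ℝ} (hc : 0 ≤ c)
    (hle : algebraMap ℝ A c ≤ h) (n : ℕ) : algebraMap ℝ A (c ^ n) ≤ h ^ n := by
  rw [← cfc_pow_id (R := ℝ) h n]
  refine algebraMap_le_cfc _ _ _ fun x hx => ?_
  exact pow_le_pow_left₀ hc ((algebraMap_le_iff_le_spectrum (a := h)).mp hle x hx) n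

theorem CStarState.le_apply_of_algebraMap_le {B : Type*} [CStarAlgebra B] (ψ : CStarState B)
    (φ : A →⋆ₐ[ℂ] B) {a : A} {r : ℝ} (hr : algebraMap ℝ A r ≤ a) :
    (r : ℂ) ≤ ψ.toLinearMap (φ a) := by
  obtain ⟨y, hy⟩ := CStarAlgebra.nonneg_iff_eq_star_mul_self.mp (sub_nonneg.mpr hr)
  have h1 := ψ.nonneg_star_mul_self (φ y)
  have h2 : φ (algebraMap ℝ A r) = (r : ℂ) • (1 : B) := by
    rw [IsScalarTower.algebraMap_apply ℝ ℂ A, AlgHomClass.commutes, Algebra.algebraMap_eq_smul_one]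
    rfl
  rw [← map_star, ← map_mul, ← hy, map_sub, map_sub, h2, map_smul, ψ.apply_one] at h1
  simpa using h1

end Powers

theorem map_eq_sum_of_sum_eq_one {A B : Type*} [CStarAlgebra A] [CStarAlgebra B] (φ : A →⋆ₐ[ℂ] B)
    (s : B) {m : ℕ} (v : Fin m → A)
    (hone : ∑ i, φ (v i) * s * star s * φ (star (v i)) = 1) {a : A} (ha : a ∈ Set.center A) :
    φ a = ∑ i, φ (v i) * s * (star s * φ a * φ (star (v i))) := by
  have hcomm : ∀ i, a * star (v i) = star (v i) * a := fun i => (Set.mem_center_iff.mp ha).comm _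
  conv_lhs => rw [← one_mul (φ a), ← hone, Finset.sum_mul]
  simp only [mul_assoc, ← map_mul, hcomm]

/-- There is no ground state as soon as `∑ uᵢ S S⋆ uᵢ⋆ = 1` for some `u₁, …, uₘ`, for any linear
map `L` in place of the transfer operator. -/
theorem not_isGroundState_of_sum_eq_one {A : Type u} [CStarAlgebra A] [PartialOrder A]
    [StarOrderedRing A] (α : A →⋆ₐ[ℂ] A) (L : A →ₗ[ℂ] A) {m : ℕ} (v : Fin m → A)
    (hone : ∑ i, CrossedProduct.ofA α L (v i) * CrossedProduct.S α L *
      star (CrossedProduct.S α L) * CrossedProduct.ofA α L (star (v i)) = 1)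
    {h : A} (hsa : IsSelfAdjoint h) (hcen : h ∈ Set.center A)
    {c : ℝ} (hc : 1 < c) (hle : algebraMap ℝ A c ≤ h) (ψ : CStarState (CrossedProduct α L)) :
    ¬ IsGroundState (gaugeAction α L hcen) ψ := by
  intro hψ
  choose K hK using fun i => hψ _ _ (isAnalyticElement_ofA_mul_S α L hcen (v i)) _
    (isEntireExtension_star_S_mul_ofA α L hcen (star (v i)))
  have hsum : ∀ n : ℕ, CrossedProduct.ofA α L (h ^ n) =
      ∑ i, CrossedProduct.ofA α L (v i) * CrossedProduct.S α L *
        (star (CrossedProduct.S α L) * CrossedProduct.ofA α L (h ^ n) *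
          CrossedProduct.ofA α L (star (v i))) := fun n =>
    map_eq_sum_of_sum_eq_one _ _ v hone ((Submonoid.center A).pow_mem hcen n)
  have hbound : ∀ n : ℕ, c ^ n ≤ ∑ i, K i := fun n => by
    have h1 := ψ.le_apply_of_algebraMap_le (CrossedProduct.ofA α L)
      (algebraMap_pow_le_pow hsa (by linarith) hle n)
    refine (Complex.le_def.mp h1).1.trans ((Complex.re_le_norm _).trans ?_)
    rw [hsum, map_sum]
    refine (norm_sum_le _ _).trans (Finset.sum_le_sum fun i _ => ?_)
    -- at `z = n i` the factor `h^{-iz}` is `h ^ n`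
    have h2 := hK i (n * Complex.I) (by simp)
    have h3 : -(Complex.I * (n * Complex.I)) = (n : ℂ) := by
      linear_combination (-(n : ℂ)) * Complex.I_mul_I
    rwa [h3, exp_natCast_smul_log (by linarith) hle] at h2
  obtain ⟨n, hn⟩ := pow_unbounded_of_one_lt (∑ i, K i) hc
  exact absurd (hbound n) (not_le.mpr hn)

theorem proposition10p1 {A : Type u} [CStarAlgebra A] [PartialOrder A] [StarOrderedRing A]
    (α : A →⋆ₐ[ℂ] A) (hα : Function.Injective α)
    (E : A →ₗ[ℂ] α.range) (hE : IsConditionalExpectation α.range E) (hfin : IsIndexFinite E)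
    (h : A) (hsa : IsSelfAdjoint h) (hcen : h ∈ Set.center A)
    (c : ℝ) (hc : 1 < c) (hle : algebraMap ℝ A c ≤ h) :
    ¬ ∃ ψ : CStarState (CrossedProduct α (transferOperator α hα E)),
      IsGroundState (gaugeAction α (transferOperator α hα E) hcen) ψ := by
  rintro ⟨ψ, hψ⟩
  obtain ⟨m, v, hv⟩ := hfin
  exact not_isGroundState_of_sum_eq_one α _ v
    (CrossedProduct.sum_mul_S_mul_star_S_mul_star_eq_one hα E v hv) hsa hcen hc hle ψ hψ
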